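/- Let $p$ and $q$ be odd prime numbers with $q-p=2$, let $\varepsilon\in\{1,-1\}$, and let $E/\mathbb{Q}$ be the elliptic curve $$E:\ y^2=x(x+\varepsilon p)(x+\varepsilon q).$$ Let $D=D_1\cdots D_n$ ($n\ge 1$) be a product of distinct odd prime numbers with $(pq,D)=1$, and let $K=\mathbb{Q}(\sqrt{D})$. Let $S$ be the set of places of $K$ consisting of the infinite places and the finite places dividing $2pq$, and let $\mathrm{Cl}_S(K)$ be the $S$-class group of $K$, i.e. the quotient of the ideal class group $\mathrm{Cl}(K)$ by the subgroup generated by the classes of the finite primes in $S$. For an abelian group $A$ write $A[2]=\{a\in A: 2a=0\}$. Then the group $E(K)$ is finitely generated, and its rank satisfies $$\operatorname{rank}E(K)\le 14+2\dim_{\mathbb{F}_2}\mathrm{Cl}_S(K)[2].$$ -/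

import Mathlib

open IsDedekindDomain

open scoped NumberField nonZeroDivisors

noncomputable section

namespace TwinPrimeCurve

/-- The Weierstrass curve `y² = x (x + ε p) (x + ε q)` over `ℚ`, that is
`y² = x³ + (ε p + ε q) x² + (ε p) (ε q) x`. -/
def curve (ε : ℤ) (p q : ℕ) : WeierstrassCurve ℚ where
  a₁ := 0
  a₂ := ε * p + ε * q
  a₃ := 0
  a₄ := (ε * p) * (ε * q)
  a₆ := 0

/-- The affine equation of the base change of `curve ε p q` to `K`. -/
theorem curve_equation_iff (ε : ℤ) (p q : ℕ) (K : Type*) [Field K] [CharZero K] (x y : K) :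
    ((curve ε p q).baseChange K).toAffine.Equation x y ↔
      y ^ 2 = x * (x + ε * p) * (x + ε * q) := by
  rw [WeierstrassCurve.Affine.equation_iff]
  simp only [WeierstrassCurve.baseChange, WeierstrassCurve.map, curve, map_zero, map_add, map_mul,
    map_natCast, map_intCast]
  constructor <;> intro h <;> linear_combination h

/-- The `S`-class group of a Dedekind domain `R`: the quotient of the ideal class group by the
subgroup generated by the classes of the primes in `S`. -/
abbrev SClassGroup (R : Type*) [CommRing R] [IsDedekindDomain R]
    (S : Set (HeightOneSpectrum R)) : Type _ :=
  ClassGroup R ⧸ Subgroup.closure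
    {c : ClassGroup R | ∃ v ∈ S,
      c = ClassGroup.mk0 ⟨v.asIdeal, mem_nonZeroDivisors_of_ne_zero v.ne_bot⟩}

/-- The finite places of a number field `K` dividing the natural number `m`. -/
def placesDividing (K : Type*) [Field K] [NumberField K] (m : ℕ) : Set (HeightOneSpectrum (𝓞 K)) :=
  {v | (m : 𝓞 K) ∈ v.asIdeal}

/-- The dimension over `𝔽₂` of the `2`-torsion `A[2]` of an abelian group `A`. -/
def dimTwoTorsion (A : Type*) [AddCommGroup A] : ℕ :=
  letI : Module (ZMod 2) (AddSubgroup.torsionBy A ((2 : ℕ) : ℤ)) :=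
    AddSubgroup.torsionBy.zmodModule
  Module.finrank (ZMod 2) (AddSubgroup.torsionBy A ((2 : ℕ) : ℤ))

end TwinPrimeCurve

end

/-! This is a complete 2-descent. The roots of the cubic are 0, -εp, -εq, so all 2-torsion is
rational, and the maps P ↦ x(P) - eᵢ into Kˣ modulo squares are homomorphisms; two of them together
have kernel 2E(K) (`exists_add_self_eq_of_isSquare`). The root differences are, up to sign, p, q and
q - p = 2, hence units outside S, so the images consist of classes with even valuation outside S
(`isSquare_valuation_descentValue`).

Such classes form an extension of a subgroup of Cl_S(K)[2] by S-units modulo squares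
(`card_evenOutside_dvd`). With r the unit rank, s the number of finite places in S and d = dim
Cl_S(K)[2], the index of 2E(K) therefore divides 2^(2(r + 1 + s + d)). Finiteness of this index and
a height descent give finite generation (`fg_of_finiteIndex_two`). Then the index is 2^rank ·
|E(K)[2]| with |E(K)[2]| ≥ 4, so rank + 2 ≤ 2(r + 1 + s + d). For K of degree at most 2, r + 1 ≤ 2
and s ≤ 6, which gives 14 + 2d. -/

namespace WeierstrassCurve.Affine.Point

/-! ### Sum and difference of points on x-coordinates. -/

open Height MvPolynomial

variable {F : Type*} [Field F] {W : WeierstrassCurve F}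

theorem eval_addSubMap_vec (s t u : F) :
    (fun i ↦ (addSubMap W i).eval ![s, t, u]) =
      ![s ^ 2 - W.b₄ * s * u - W.b₆ * t * u - W.b₈ * u ^ 2,
        2 * t * s + W.b₂ * s * u + W.b₄ * t * u + W.b₆ * u ^ 2, t ^ 2 - 4 * s * u] := by
  ext i; fin_cases i <;> simp [addSubMap]

theorem vec_three_eq_smul {a b c a' b' c' k : F} (ha : a = k * a') (hb : b = k * b')
    (hc : c = k * c') : ![a, b, c] = k • ![a', b', c'] := by
  simp [ha, hb, hc]

variable [DecidableEq F]

theorem exists_sym2x_add_self [W.IsElliptic] (P : W.toAffine.Point) :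
    ∃ c : F, c ≠ 0 ∧
      (P + P).sym2x 0 = c • fun i ↦ (addSubMap W i).eval (P.sym2x P) := by
  rcases P with _ | ⟨x, y, h⟩
  · refine ⟨1, one_ne_zero, ?_⟩
    rw [← zero_def, add_zero, sym2x_zero_zero, eval_addSubMap_vec]
    simp
  · have heq := (W.toAffine.equation_iff x y).mp h.1
    rw [sym2x_some_some]
    have hne : (fun i ↦ (addSubMap W i).eval ![x * x, x + x, 1]) ≠ 0 :=
      addSubMap_ne_zero W fun h ↦ by simpa using congrFun h 2
    rw [eval_addSubMap_vec] at hne ⊢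
    by_cases hy : y = W.toAffine.negY x y
    · rw [add_self_of_Y_eq hy, sym2x_zero_zero]
      have hy' : 2 * y + W.a₁ * x + W.a₃ = 0 := by rw [Affine.negY] at hy; linear_combination hy
      have h1 : 2 * (x + x) * (x * x) + W.b₂ * (x * x) * 1 + W.b₄ * (x + x) * 1 + W.b₆ * 1 ^ 2
          = 0 := by
        rw [b₂, b₄, b₆]
        linear_combination (2 * y + W.a₁ * x + W.a₃) * hy' - 4 * heq
      have h2 : (x + x) ^ 2 - 4 * (x * x) * 1 = 0 := by ring
      rw [h1, h2] at hne ⊢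
      -- Here P is 2-torsion and P + P = 0. The middle coordinate is (2y + a₁x + a₃)² = 0, and as
      -- `addSubMap` has no common zero on an elliptic curve, the first coordinate must survive.
      have h0 : (x * x) ^ 2 - W.b₄ * (x * x) * 1 - W.b₆ * (x + x) * 1 - W.b₈ * 1 ^ 2 ≠ 0 :=
        fun h0 ↦ hne (by rw [h0]; simp)
      exact ⟨_, inv_ne_zero h0, vec_three_eq_smul (inv_mul_cancel₀ h0).symm (by simp) (by simp)⟩
    · have hd : y - W.toAffine.negY x y ≠ 0 := sub_ne_zero.mpr hy
      rw [add_self_of_Y_ne hy, sym2x_some_zero]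
      refine ⟨((y - W.toAffine.negY x y) ^ 2)⁻¹, inv_ne_zero (pow_ne_zero 2 hd),
        vec_three_eq_smul ?_ ?_ ?_⟩
      · rw [slope_of_Y_ne rfl hy, Affine.addX, b₄, b₆, b₈]
        field_simp
        rw [Affine.negY]
        linear_combination -(W.a₁ ^ 2 + 4 * W.a₂ + 8 * x) * heq
      · rw [b₂, b₄, b₆, eq_inv_mul_iff_mul_eq₀ (pow_ne_zero 2 hd), Affine.negY]
        linear_combination 4 * heq
      · ring

/-- The map `addSubMap` describes `(P, Q) ↦ (P + Q, P - Q)` on `x`-coordinates, up to scaling. -/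
theorem exists_sym2x_add_sub [W.IsElliptic] (P Q : W.toAffine.Point) :
    ∃ c : F, c ≠ 0 ∧
      (P + Q).sym2x (P - Q) = c • fun i ↦ (addSubMap W i).eval (P.sym2x Q) := by
  by_cases hPQ : P.xRep = Q.xRep
  · rcases eq_or_eq_neg_of_xRep_eq_xRep hPQ with rfl | rfl
    · simpa using exists_sym2x_add_self P
    · obtain ⟨c, hc, h⟩ := exists_sym2x_add_self Q
      refine ⟨c, hc, ?_⟩
      rw [sym2x_neg_left, ← h, neg_add_cancel, sym2x_comm, ← sym2x_neg_left]
      congr 1; abel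
  rcases P with _ | ⟨x₁, y₁, h₁⟩
  · refine ⟨1, one_ne_zero, ?_⟩
    rw [← zero_def, zero_add, zero_sub, sym2x_neg_right]
    rcases Q with _ | ⟨x, y, h⟩
    · exact absurd rfl hPQ
    · rw [sym2x_some_some, sym2x_zero_some, eval_addSubMap_vec]
      exact vec_three_eq_smul (by ring) (by ring) (by ring)
  rcases Q with _ | ⟨x₂, y₂, h₂⟩
  · refine ⟨1, one_ne_zero, ?_⟩
    rw [← zero_def, add_zero, sub_zero, sym2x_some_some, sym2x_some_zero, eval_addSubMap_vec]
    exact vec_three_eq_smul (by ring) (by ring) (by ring)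
  have hx : x₁ ≠ x₂ := by rintro rfl; simp at hPQ
  have hx' : x₁ - x₂ ≠ 0 := sub_ne_zero.mpr hx
  have e₁ := (W.toAffine.equation_iff x₁ y₁).mp h₁.1
  have e₂ := (W.toAffine.equation_iff x₂ y₂).mp h₂.1
  refine ⟨((x₁ - x₂) ^ 2)⁻¹, inv_ne_zero (pow_ne_zero 2 hx'), ?_⟩
  rw [sub_eq_add_neg, neg_some, add_of_X_ne hx, add_of_X_ne hx, sym2x_some_some, sym2x_some_some,
    slope_of_X_ne hx, slope_of_X_ne hx, Affine.addX, Affine.addX, Affine.negY, eval_addSubMap_vec]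
  refine vec_three_eq_smul ?_ ?_ ?_
  · rw [b₄, b₆, b₈]
    field_simp
    linear_combination ((y₁ - y₂) * (y₁ + y₂ + W.a₁ * x₂ + W.a₃) +
        (x₁ - x₂) * (x₁ ^ 2 + x₁ * x₂ + x₂ ^ 2 + W.a₂ * (x₁ + x₂) + W.a₄ - W.a₁ * y₁) +
        W.a₁ * (x₁ - x₂) * (2 * y₁ + W.a₁ * x₂ + W.a₃) + W.a₁ ^ 2 * (x₁ - x₂) ^ 2 +
        2 * (W.a₂ + x₁ + x₂) * (x₁ - x₂) ^ 2) * (e₁ - e₂) -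
      (x₁ - x₂) ^ 2 * (W.a₁ ^ 2 + 4 * (W.a₂ + x₁ + x₂)) * e₁
  · rw [b₂, b₄, b₆]
    field_simp
    linear_combination 2 * e₁ + 2 * e₂
  · field_simp
    ring

end WeierstrassCurve.Affine.Point

/-! ### Naive height and reduction to weak Mordell-Weil. -/

namespace WeierstrassCurve.Affine.Point

open Height MvPolynomial

variable {F : Type*} [Field F] {W : WeierstrassCurve F}

/-- The naïve logarithmic height of a point: the height of its `x`-coordinate. -/
noncomputable def naiveHeight [AdmissibleAbsValues F] (P : W.toAffine.Point) : ℝ :=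
  logHeight P.xRep

theorem naiveHeight_nonneg [AdmissibleAbsValues F] (P : W.toAffine.Point) : 0 ≤ naiveHeight P :=
  logHeight_nonneg _

/-- The approximate parallelogram law for the naïve height. -/
theorem exists_abs_naiveHeight_parallelogram_le [AdmissibleAbsValues F] [DecidableEq F]
    [W.IsElliptic] :
    ∃ C, ∀ P Q : W.toAffine.Point,
      |naiveHeight (P + Q) + naiveHeight (P - Q) - 2 * (naiveHeight P + naiveHeight Q)| ≤ C := by
  obtain ⟨C₁, h₁⟩ := abs_logHeight_addSubMap_sub_two_mul_logHeight_le W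
  obtain ⟨C₂, h₂⟩ := abs_logHeight_sym2_sub_le F
  have key (P Q : W.toAffine.Point) :
      |logHeight (P.sym2x Q) - (naiveHeight P + naiveHeight Q)| ≤ C₂ := by
    have hv (R : W.toAffine.Point) : ![R.xRep 0, R.xRep 1] = R.xRep := by
      ext i; fin_cases i <;> rfl
    have := h₂ (a := P.xRep 0) (b := P.xRep 1) (c := Q.xRep 0) (d := Q.xRep 1)
      (by rw [hv]; exact xRep_ne_zero P) (by rw [hv]; exact xRep_ne_zero Q)
    rwa [hv, hv] at this
  -- One `C₂` compares heights for the pair (P + Q, P - Q); two more come from the pair (P, Q),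
  -- whose height is doubled by `addSubMap`.
  refine ⟨C₁ + 3 * C₂, fun P Q ↦ ?_⟩
  obtain ⟨c, hc, h⟩ := exists_sym2x_add_sub P Q
  have k₁ := key (P + Q) (P - Q)
  have k₂ := key P Q
  have k₃ := h₁ (P.sym2x Q)
  rw [h, logHeight_smul_eq_logHeight _ hc] at k₁
  rw [abs_le] at *
  constructor <;> linarith [k₁.1, k₁.2, k₂.1, k₂.2, k₃.1, k₃.2]

instance northcott_naiveHeight [AdmissibleAbsValues F] [Northcott (logHeight₁ (K := F))] :
    Northcott (naiveHeight (W := W)) where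
  finite_le B := by
    have hfib (v : Fin 2 → F) : (xRep (W' := W.toAffine) ⁻¹' {v}).Finite := by
      rcases (xRep (W' := W.toAffine) ⁻¹' {v}).eq_empty_or_nonempty with h | ⟨P, hP⟩
      · simp [h]
      · refine (Set.toFinite {P, -P}).subset fun Q hQ ↦ ?_
        exact eq_or_eq_neg_of_xRep_eq_xRep (hQ.trans hP.symm)
    have hfin : ({![1, 0]} ∪ (fun x : F ↦ ![x, 1]) '' {x | logHeight₁ x ≤ B}).Finite :=
      (Set.finite_singleton _).union ((Northcott.finite_le B).image _)
    refine (hfin.preimage' fun v _ ↦ hfib v).subset fun P hP ↦ ?_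
    rcases P with _ | ⟨x, y, h⟩
    · exact Or.inl rfl
    · refine Or.inr ⟨x, ?_, (xRep_some h).symm⟩
      simpa [naiveHeight, logHeight₁_eq_logHeight] using hP

/-- An elliptic curve over a number field has a finitely generated group of points as soon as
the weak Mordell-Weil theorem holds for multiplication by `2`. -/
theorem fg_of_finiteIndex_two {K : Type*} [Field K] [NumberField K] [DecidableEq K]
    {W : WeierstrassCurve K} [W.IsElliptic]
    (h : (nsmulAddMonoidHom (α := W.toAffine.Point) 2).range.FiniteIndex) :
    AddGroup.FG W.toAffine.Point := by
  obtain ⟨C, hC⟩ := exists_abs_naiveHeight_parallelogram_le (W := W)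
  exact AddCommGroup.fg_of_descent' h naiveHeight_nonneg hC

end WeierstrassCurve.Affine.Point

/-! ### The 2-descent map of a cubic with three rational roots. -/

namespace WeierstrassCurve

variable {F : Type*} [Field F]

/-- The Weierstrass curve `W` is given by `y² = (x - e₁) (x - e₂) (x - e₃)`
with pairwise distinct `e₁`, `e₂`, `e₃`. -/
structure IsSplit (W : WeierstrassCurve F) (e₁ e₂ e₃ : F) : Prop where
  a₁ : W.a₁ = 0
  a₂ : W.a₂ = -(e₁ + e₂ + e₃)
  a₃ : W.a₃ = 0
  a₄ : W.a₄ = e₁ * e₂ + e₁ * e₃ + e₂ * e₃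
  a₆ : W.a₆ = -(e₁ * e₂ * e₃)
  ne₁₂ : e₁ ≠ e₂
  ne₁₃ : e₁ ≠ e₃
  ne₂₃ : e₂ ≠ e₃

namespace IsSplit

variable {W : WeierstrassCurve F} {e₁ e₂ e₃ : F}

theorem rotate (h : W.IsSplit e₁ e₂ e₃) : W.IsSplit e₂ e₃ e₁ where
  a₁ := h.a₁
  a₂ := by rw [h.a₂]; ring
  a₃ := h.a₃
  a₄ := by rw [h.a₄]; ring
  a₆ := by rw [h.a₆]; ring
  ne₁₂ := h.ne₂₃
  ne₁₃ := h.ne₁₂.symm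
  ne₂₃ := h.ne₁₃.symm

theorem isElliptic (h : W.IsSplit e₁ e₂ e₃) (h2 : (2 : F) ≠ 0) : W.IsElliptic where
  isUnit := by
    have : W.Δ = (2 ^ 2 * (e₁ - e₂) * (e₁ - e₃) * (e₂ - e₃)) ^ 2 := by
      rw [Δ, b₂, b₄, b₆, b₈, h.a₁, h.a₂, h.a₃, h.a₄, h.a₆]; ring
    rw [this, isUnit_iff_ne_zero]
    have := sub_ne_zero.mpr h.ne₁₂
    have := sub_ne_zero.mpr h.ne₁₃
    have := sub_ne_zero.mpr h.ne₂₃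
    positivity

theorem equation_iff (h : W.IsSplit e₁ e₂ e₃) (x y : F) :
    W.toAffine.Equation x y ↔ y ^ 2 = (x - e₁) * (x - e₂) * (x - e₃) := by
  rw [Affine.equation_iff, h.a₁, h.a₂, h.a₃, h.a₄, h.a₆]
  constructor <;> intro h <;> linear_combination h

theorem negY_eq (h : W.IsSplit e₁ e₂ e₃) (x y : F) : W.toAffine.negY x y = -y := by
  rw [Affine.negY, h.a₁, h.a₃]; ring

end IsSplit

namespace Affine.Point

open Polynomial

variable [DecidableEq F] {W : WeierstrassCurve F} {e₁ e₂ e₃ : F}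

/-- A representative of the first component of the `2`-descent map, attached to the root `e₁`. -/
def descentValue (W : WeierstrassCurve F) (e₁ e₂ e₃ : F) : W.toAffine.Point → F
  | .zero => 1
  | .some x _ _ => if x = e₁ then (e₁ - e₂) * (e₁ - e₃) else x - e₁

theorem descentValue_zero : descentValue W e₁ e₂ e₃ 0 = 1 := rfl

theorem descentValue_some {x y : F} (h : W.toAffine.Nonsingular x y) :
    descentValue W e₁ e₂ e₃ (.some x y h) =
      if x = e₁ then (e₁ - e₂) * (e₁ - e₃) else x - e₁ := rfl

theorem descentValue_ne_zero (h : W.IsSplit e₁ e₂ e₃) (P : W.toAffine.Point) :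
    descentValue W e₁ e₂ e₃ P ≠ 0 := by
  rcases P with _ | ⟨x, y, hP⟩
  · exact one_ne_zero
  · rw [descentValue_some]
    split_ifs with hx
    · exact mul_ne_zero (sub_ne_zero.mpr h.ne₁₂) (sub_ne_zero.mpr h.ne₁₃)
    · exact sub_ne_zero.mpr hx

/-- Vieta's formulas for the intersection of the curve with the line through two points. -/
theorem exists_line_of_add_eq (h : W.IsSplit e₁ e₂ e₃) {x₁ y₁ x₂ y₂ x₃ y₃ : F}
    {h₁ : W.toAffine.Nonsingular x₁ y₁} {h₂ : W.toAffine.Nonsingular x₂ y₂}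
    {h₃ : W.toAffine.Nonsingular x₃ y₃}
    (hadd : Point.some x₁ y₁ h₁ + Point.some x₂ y₂ h₂ = Point.some x₃ y₃ h₃) :
    ∃ l m : F, x₁ + x₂ + x₃ = e₁ + e₂ + e₃ + l ^ 2 ∧
      x₁ * x₂ + x₁ * x₃ + x₂ * x₃ = e₁ * e₂ + e₁ * e₃ + e₂ * e₃ - 2 * l * m ∧
      x₁ * x₂ * x₃ = e₁ * e₂ * e₃ + m ^ 2 := by
  have hxy : ¬(x₁ = x₂ ∧ y₁ = W.toAffine.negY x₂ y₂) := by
    rintro ⟨hx, hy⟩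
    rw [add_of_Y_eq hx hy] at hadd
    exact some_ne_zero h₃ hadd.symm
  rw [add_some hxy, Point.some.injEq] at hadd
  have key := Affine.addPolynomial_slope h₁.1 h₂.1 hxy
  rw [Affine.addPolynomial_eq, neg_inj, hadd.1] at key
  have hc := Cubic.prod_X_sub_C_eq (x := x₁) (y := x₂) (z := x₃)
  rw [← key, Cubic.toPoly_injective, Cubic.mk.injEq, h.a₁, h.a₂, h.a₃, h.a₄, h.a₆] at hc
  set l := W.toAffine.slope x₁ x₂ y₁ y₂
  refine ⟨l, y₁ - l * x₁, ?_, ?_, ?_⟩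
  · linear_combination hc.2.1
  · linear_combination -hc.2.2.1
  · linear_combination hc.2.2.2

/-- If y = lx + m is the line through P and Q, evaluating the cubic at e₁ gives ∏ (xᵢ - e₁) = (l e₁
+ m)². If one xᵢ equals e₁, then l e₁ + m = 0 and the substitute value (e₁ - e₂)(e₁ - e₃) is exactly
the product of the other two factors, neither of which vanishes. -/
theorem isSquare_descentValue_mul (h : W.IsSplit e₁ e₂ e₃) (P Q : W.toAffine.Point) :
    IsSquare (descentValue W e₁ e₂ e₃ P * descentValue W e₁ e₂ e₃ Q *
      descentValue W e₁ e₂ e₃ (P + Q)) := by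
  rcases P with _ | ⟨x₁, y₁, h₁⟩
  · rw [← zero_def, zero_add, descentValue_zero, one_mul]; exact IsSquare.mul_self _
  rcases Q with _ | ⟨x₂, y₂, h₂⟩
  · rw [← zero_def, add_zero, descentValue_zero, mul_one]; exact IsSquare.mul_self _
  rcases hR : Point.some x₁ y₁ h₁ + Point.some x₂ y₂ h₂ with _ | ⟨x₃, y₃, h₃⟩
  · have : Point.some x₁ y₁ h₁ = -Point.some x₂ y₂ h₂ := eq_neg_of_add_eq_zero_left hR
    rw [neg_some, Point.some.injEq] at this
    rw [← zero_def, descentValue_zero, mul_one, descentValue_some, descentValue_some, this.1]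
    exact IsSquare.mul_self _
  obtain ⟨l, m, s₁, s₂, s₃⟩ := exists_line_of_add_eq h hR
  have hprod : (x₁ - e₁) * (x₂ - e₁) * (x₃ - e₁) = (l * e₁ + m) ^ 2 := by
    linear_combination e₁ ^ 2 * s₁ - e₁ * s₂ + s₃
  have hd : (e₁ - e₂) * (e₁ - e₃) ≠ 0 :=
    mul_ne_zero (sub_ne_zero.mpr h.ne₁₂) (sub_ne_zero.mpr h.ne₁₃)
  have hsp (a b c : F) (ha : a = e₁) (t₁ : a + b + c = e₁ + e₂ + e₃ + l ^ 2)
      (t₂ : a * b + a * c + b * c = e₁ * e₂ + e₁ * e₃ + e₂ * e₃ - 2 * l * m)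
      (t₃ : (l * e₁ + m) ^ 2 = 0) : b ≠ e₁ ∧ c ≠ e₁ ∧
        (e₁ - e₂) * (e₁ - e₃) = (b - e₁) * (c - e₁) := by
    have t₄ : l * e₁ + m = 0 := by simpa using t₃
    have : (e₁ - e₂) * (e₁ - e₃) = (b - e₁) * (c - e₁) := by
      subst ha
      linear_combination 2 * a * t₁ - t₂ + 2 * l * t₄
    refine ⟨?_, ?_, this⟩ <;> rintro rfl <;> simp [this] at hd
  rw [descentValue_some, descentValue_some, descentValue_some]
  by_cases c₁ : x₁ = e₁
  · obtain ⟨n₂, n₃, hv⟩ := hsp x₁ x₂ x₃ c₁ s₁ s₂ (by rw [← hprod, c₁]; ring)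
    rw [if_pos c₁, if_neg n₂, if_neg n₃, hv]
    exact ⟨(x₂ - e₁) * (x₃ - e₁), by ring⟩
  by_cases c₂ : x₂ = e₁
  · obtain ⟨n₂, n₃, hv⟩ := hsp x₂ x₁ x₃ c₂ (by rw [← s₁]; ring) (by rw [← s₂]; ring)
      (by rw [← hprod, c₂]; ring)
    rw [if_neg n₂, if_pos c₂, if_neg n₃, hv]
    exact ⟨(x₁ - e₁) * (x₃ - e₁), by ring⟩
  by_cases c₃ : x₃ = e₁
  · obtain ⟨n₂, n₃, hv⟩ := hsp x₃ x₁ x₂ c₃ (by rw [← s₁]; ring) (by rw [← s₂]; ring)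
      (by rw [← hprod, c₃]; ring)
    rw [if_neg n₂, if_neg n₃, if_pos c₃, hv]
    exact ⟨(x₁ - e₁) * (x₂ - e₁), by ring⟩
  rw [if_neg c₁, if_neg c₂, if_neg c₃, hprod]
  exact ⟨l * e₁ + m, sq _⟩

/-- The `2`-descent map attached to the root `e₁`. -/
def descentMap (h : W.IsSplit e₁ e₂ e₃) :
    Multiplicative W.toAffine.Point →* Fˣ ⧸ (powMonoidHom 2 : Fˣ →* Fˣ).range :=
  .mk' (fun P ↦ QuotientGroup.mk (Units.mk0 _ (descentValue_ne_zero h P.toAdd))) fun P Q ↦ by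
    rw [← QuotientGroup.mk_mul, eq_comm, QuotientGroup.eq]
    obtain ⟨r, hr⟩ := isSquare_descentValue_mul h P.toAdd Q.toAdd
    have hP := descentValue_ne_zero h P.toAdd
    have hQ := descentValue_ne_zero h Q.toAdd
    have hR := descentValue_ne_zero h (P.toAdd + Q.toAdd)
    have hr0 : r ≠ 0 := by
      rintro rfl
      simp_all
    refine ⟨Units.mk0 r hr0 * (Units.mk0 _ hP)⁻¹ * (Units.mk0 _ hQ)⁻¹, ?_⟩
    ext
    simp only [powMonoidHom_apply, Units.val_pow_eq_pow_val, Units.val_mul, Units.val_inv_eq_inv_val,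
      Units.val_mk0, toAdd_mul]
    field_simp
    rw [sq, ← hr]

theorem descentMap_apply (h : W.IsSplit e₁ e₂ e₃) (P : W.toAffine.Point) :
    descentMap h (Multiplicative.ofAdd P) =
      QuotientGroup.mk (Units.mk0 _ (descentValue_ne_zero h P)) := rfl

theorem isSquare_descentValue_of_descentMap_eq_one (h : W.IsSplit e₁ e₂ e₃)
    {P : W.toAffine.Point} (hP : descentMap h (Multiplicative.ofAdd P) = 1) :
    IsSquare (descentValue W e₁ e₂ e₃ P) := by
  rw [descentMap_apply, QuotientGroup.eq_one_iff] at hP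
  obtain ⟨u, hu⟩ := hP
  refine ⟨u, ?_⟩
  have := congrArg Units.val hu
  simpa [sq] using this.symm

/-- A point all of whose differences `x - eᵢ` are squares is divisible by `2`. -/
theorem exists_add_self_eq_some (h : W.IsSplit e₁ e₂ e₃) (h2 : (2 : F) ≠ 0) {x y : F}
    (hP : W.toAffine.Nonsingular x y) {t₁ t₂ t₃ : F} (ht₁ : x - e₁ = t₁ ^ 2)
    (ht₂ : x - e₂ = t₂ ^ 2) (ht₃ : x - e₃ = t₃ ^ 2) :
    ∃ Q : W.toAffine.Point, Q + Q = .some x y hP := by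
  have := h.isElliptic h2
  -- The equation fixes y only up to sign; changing the sign of t₁ adjusts it.
  wlog hy : y = -(t₁ * t₂ * t₃) generalizing t₁
  · refine this (t₁ := -t₁) (by rw [ht₁]; ring) ?_
    have : y ^ 2 = (t₁ * t₂ * t₃) ^ 2 := by
      rw [(h.equation_iff x y).mp hP.1, ht₁, ht₂, ht₃]; ring
    rcases sq_eq_sq_iff_eq_or_eq_neg.mp this with h | h
    · rw [h]; ring
    · exact absurd h hy
  have n₁₂ : t₁ + t₂ ≠ 0 := fun h0 ↦ h.ne₁₂ (by linear_combination ht₂ - ht₁ + (t₂ - t₁) * h0)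
  have n₁₃ : t₁ + t₃ ≠ 0 := fun h0 ↦ h.ne₁₃ (by linear_combination ht₃ - ht₁ + (t₃ - t₁) * h0)
  have n₂₃ : t₂ + t₃ ≠ 0 := fun h0 ↦ h.ne₂₃ (by linear_combination ht₃ - ht₂ + (t₃ - t₂) * h0)
  obtain rfl : e₁ = x - t₁ ^ 2 := by linear_combination -ht₁
  obtain rfl : e₂ = x - t₂ ^ 2 := by linear_combination -ht₂
  obtain rfl : e₃ = x - t₃ ^ 2 := by linear_combination -ht₃
  -- The classical halving formula: the tangent at this point has slope -(t₁ + t₂ + t₃) and leads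
  -- back to P.
  have heq : W.toAffine.Equation (x + t₁ * t₂ + t₁ * t₃ + t₂ * t₃)
      (-((t₁ + t₂) * (t₁ + t₃) * (t₂ + t₃))) := by
    rw [h.equation_iff]; ring
  have hY : -((t₁ + t₂) * (t₁ + t₃) * (t₂ + t₃)) ≠
      W.toAffine.negY (x + t₁ * t₂ + t₁ * t₃ + t₂ * t₃)
        (-((t₁ + t₂) * (t₁ + t₃) * (t₂ + t₃))) := by
    rw [h.negY_eq, ne_eq, ← sub_eq_zero]
    have : -((t₁ + t₂) * (t₁ + t₃) * (t₂ + t₃)) - - -((t₁ + t₂) * (t₁ + t₃) * (t₂ + t₃)) =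
      -(2 * (t₁ + t₂) * (t₁ + t₃) * (t₂ + t₃)) := by ring
    rw [this]
    simp [h2, n₁₂, n₁₃, n₂₃]
  have hsl : W.toAffine.slope (x + t₁ * t₂ + t₁ * t₃ + t₂ * t₃)
      (x + t₁ * t₂ + t₁ * t₃ + t₂ * t₃) (-((t₁ + t₂) * (t₁ + t₃) * (t₂ + t₃)))
      (-((t₁ + t₂) * (t₁ + t₃) * (t₂ + t₃))) = -(t₁ + t₂ + t₃) := by
    rw [slope_of_Y_ne rfl hY, div_eq_iff (sub_ne_zero.mpr hY), h.negY_eq, h.a₁, h.a₂, h.a₄]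
    ring
  refine ⟨.some _ _ (Affine.equation_iff_nonsingular.mp heq), ?_⟩
  rw [add_self_of_Y_ne hY, Point.some.injEq, hsl, Affine.addY, Affine.negAddY, Affine.addX,
    h.negY_eq, h.a₁, h.a₂]
  constructor
  · ring
  · rw [hy]; ring

/-- Two components suffice, since the three differences multiply to y². At a root, the substitute
value supplies the missing square. -/
theorem exists_add_self_eq_of_isSquare (h : W.IsSplit e₁ e₂ e₃) (h2 : (2 : F) ≠ 0)
    (P : W.toAffine.Point) (h₁ : IsSquare (descentValue W e₁ e₂ e₃ P))
    (h₂ : IsSquare (descentValue W e₂ e₃ e₁ P)) :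
    ∃ Q : W.toAffine.Point, Q + Q = P := by
  rcases P with _ | ⟨x, y, hP⟩
  · exact ⟨0, add_zero 0⟩
  have heq := (h.equation_iff x y).mp hP.1
  rw [descentValue_some] at h₁ h₂
  have hdiv {a b : F} (ha : a ≠ 0) (h₁ : IsSquare a) (h₂ : IsSquare (a * b)) : IsSquare b := by
    have := h₂.div h₁
    rwa [mul_div_cancel_left₀ _ ha] at this
  have s₁ : IsSquare (x - e₁) := by
    split_ifs at h₁ with hx
    · simp [hx]
    · exact h₁
  have s₂ : IsSquare (x - e₂) := by
    split_ifs at h₂ with hx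
    · simp [hx]
    · exact h₂
  have s₃ : IsSquare (x - e₃) := by
    by_cases c₁ : x = e₁
    · rw [if_pos c₁] at h₁
      rw [c₁] at s₂ ⊢
      exact hdiv (sub_ne_zero.mpr h.ne₁₂) s₂ h₁
    by_cases c₂ : x = e₂
    · rw [if_pos c₂] at h₂
      rw [c₂] at s₁ ⊢
      exact hdiv (sub_ne_zero.mpr h.ne₁₂.symm) s₁ (by rwa [mul_comm])
    · exact hdiv (mul_ne_zero (sub_ne_zero.mpr c₁) (sub_ne_zero.mpr c₂)) (s₁.mul s₂)
        ⟨y, by rw [← heq, sq]⟩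
  obtain ⟨t₁, ht₁⟩ := s₁
  obtain ⟨t₂, ht₂⟩ := s₂
  obtain ⟨t₃, ht₃⟩ := s₃
  exact exists_add_self_eq_some h h2 hP (ht₁.trans (sq _).symm) (ht₂.trans (sq _).symm)
    (ht₃.trans (sq _).symm)

end Affine.Point

end WeierstrassCurve

/-! ### Parity of valuations of descent values. -/

namespace WeierstrassCurve.Affine.Point

variable {F : Type*} [Field F] {W : WeierstrassCurve F} {e₁ e₂ e₃ : F}

/-- If the differences of the roots are units for a valuation, then the descent map takes values
of even valuation. -/
theorem isSquare_valuation_descentValue [DecidableEq F] {Γ : Type*}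
    [LinearOrderedCommGroupWithZero Γ] (v : Valuation F Γ) (h : W.IsSplit e₁ e₂ e₃)
    (h₁₂ : v (e₁ - e₂) = 1) (h₁₃ : v (e₁ - e₃) = 1) (P : W.toAffine.Point) :
    IsSquare (v (descentValue W e₁ e₂ e₃ P)) := by
  rcases P with _ | ⟨x, y, hP⟩
  · rw [← zero_def, descentValue_zero, map_one]; exact .one
  rw [descentValue_some]
  split_ifs with hx
  · rw [map_mul, h₁₂, h₁₃, mul_one]; exact .one
  have heq := congrArg v ((h.equation_iff x y).mp hP.1)
  rw [map_pow, map_mul, map_mul] at heq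
  have r₂ : x - e₂ = (x - e₁) + (e₁ - e₂) := by ring
  have r₃ : x - e₃ = (x - e₁) + (e₁ - e₃) := by ring
  -- Below 1, the other two factors have value 1, so v(x - e₁) = v(y)². Above 1, all three factors
  -- have equal value, so v(x - e₁)³ = v(y)².
  rcases lt_trichotomy (v (x - e₁)) 1 with hlt | h1 | hgt
  · rw [r₂, r₃, v.map_add_eq_of_lt_right (hlt.trans_eq h₁₂.symm),
      v.map_add_eq_of_lt_right (hlt.trans_eq h₁₃.symm), h₁₂, h₁₃, mul_one, mul_one] at heq
    exact ⟨v y, by rw [← heq, sq]⟩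
  · rw [h1]; exact .one
  · rw [r₂, r₃, v.map_add_eq_of_lt_left (h₁₂.trans_lt hgt),
      v.map_add_eq_of_lt_left (h₁₃.trans_lt hgt)] at heq
    have h0 : v (x - e₁) ≠ 0 := (v.ne_zero_iff).mpr (sub_ne_zero.mpr hx)
    refine ⟨v y / v (x - e₁), ?_⟩
    rw [div_mul_div_comm, ← sq, heq, mul_assoc, mul_div_cancel_right₀ _ (mul_ne_zero h0 h0)]

end WeierstrassCurve.Affine.Point

/-! ### Fractional ideals, S-units and S-classes. -/

namespace IsDedekindDomain

open FractionalIdeal TwinPrimeCurve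

variable {R : Type*} [CommRing R] [IsDedekindDomain R] {K : Type*} [Field K] [Algebra R K]
  [IsFractionRing R K] {S : Set (HeightOneSpectrum R)}

/-- The sign appears because the multiplicative valuation is small where the order is large. -/
theorem HeightOneSpectrum.count_spanSingleton (v : HeightOneSpectrum R) (x : Kˣ) :
    count K v (spanSingleton R⁰ (x : K)) = -(v.valuationOfNeZero x).toAdd := by
  classical
  set s := IsLocalization.sec R⁰ (x : K)
  have hs : (x : K) * algebraMap R K s.2 = algebraMap R K s.1 := IsLocalization.sec_spec R⁰ (x : K)
  have h2 : algebraMap R K s.2 ≠ 0 := IsFractionRing.to_map_ne_zero_of_mem_nonZeroDivisors s.2.2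
  have hx : spanSingleton R⁰ (x : K) ≠ 0 :=
    spanSingleton_ne_zero_iff.mpr x.ne_zero
  rw [count_well_defined K v hx (a := s.2) (J := Ideal.span {s.1})]
  · change _ = -((-_ : ℤ) - (-_))
    ring
  · rw [coeIdeal_span_singleton, spanSingleton_mul_spanSingleton, ← hs]
    congr 1
    field_simp

theorem mem_unit_iff (x : Kˣ) : x ∈ S.unit K ↔ ∀ v ∉ S, v.valuationOfNeZero x = 1 := by
  rw [Set.unit_eq]
  simp only [Subgroup.mem_iInf]
  refine forall₂_congr fun v _ ↦ ?_
  rw [← WithZero.coe_inj, HeightOneSpectrum.valuationOfNeZero_eq]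
  simp only [Valuation.mem_unitGroup_iff, WithZero.coe_one]

theorem mk_mem_closure_of_count_eq_zero {I : (FractionalIdeal R⁰ K)ˣ}
    (h : ∀ v ∉ S, count K v (I : FractionalIdeal R⁰ K) = 0) :
    ClassGroup.mk K I ∈ Subgroup.closure
      {c : ClassGroup R | ∃ v ∈ S,
        c = ClassGroup.mk0 ⟨v.asIdeal, mem_nonZeroDivisors_of_ne_zero v.ne_bot⟩} := by
  have hfin := finite_factors (K := K) (I : FractionalIdeal R⁰ K)
  rw [Filter.eventually_cofinite] at hfin
  have hI : I = ∏ v ∈ hfin.toFinset, FractionalIdeal.mk0 K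
      (⟨v.asIdeal, mem_nonZeroDivisors_of_ne_zero v.ne_bot⟩ : (Ideal R)⁰) ^
        count K v (I : FractionalIdeal R⁰ K) := by
    ext1
    conv_lhs => rw [← finprod_heightOneSpectrum_factorization' K I.ne_zero]
    rw [finprod_eq_finsetProd_of_mulSupport_subset (s := hfin.toFinset)]
    · simp
    · intro v hv
      simp only [Set.Finite.coe_toFinset, Set.mem_ofPred_eq]
      intro h0
      simp [h0] at hv
  rw [hI, map_prod]
  refine Subgroup.prod_mem _ fun v hv ↦ ?_
  rw [map_zpow, ClassGroup.mk_mk0]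
  refine Subgroup.zpow_mem _ ?_ _
  refine Subgroup.subset_closure ⟨v, ?_, rfl⟩
  by_contra hvS
  simp [h v hvS] at hv

theorem count_units_mul (v : HeightOneSpectrum R) (I J : (FractionalIdeal R⁰ K)ˣ) :
    count K v ((I * J : (FractionalIdeal R⁰ K)ˣ) : FractionalIdeal R⁰ K) =
      count K v (I : FractionalIdeal R⁰ K) + count K v (J : FractionalIdeal R⁰ K) := by
  rw [Units.val_mul, count_mul K v I.ne_zero J.ne_zero]

theorem count_units_inv (v : HeightOneSpectrum R) (I : (FractionalIdeal R⁰ K)ˣ) :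
    count K v ((I⁻¹ : (FractionalIdeal R⁰ K)ˣ) : FractionalIdeal R⁰ K) =
      -count K v (I : FractionalIdeal R⁰ K) := by
  rw [Units.val_inv_eq_inv_val, count_inv]

variable (K) in
theorem exists_mk_eq_of_mem_closure {c : ClassGroup R} (hc : c ∈ Subgroup.closure
      {c : ClassGroup R | ∃ v ∈ S,
        c = ClassGroup.mk0 ⟨v.asIdeal, mem_nonZeroDivisors_of_ne_zero v.ne_bot⟩}) :
    ∃ I : (FractionalIdeal R⁰ K)ˣ, ClassGroup.mk K I = c ∧
      ∀ v ∉ S, count K v (I : FractionalIdeal R⁰ K) = 0 := by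
  induction hc using Subgroup.closure_induction with
  | mem c hc =>
    obtain ⟨w, hw, rfl⟩ := hc
    refine ⟨FractionalIdeal.mk0 K ⟨w.asIdeal, mem_nonZeroDivisors_of_ne_zero w.ne_bot⟩,
      ClassGroup.mk_mk0 _ _, fun v hv ↦ ?_⟩
    rw [FractionalIdeal.coe_mk0]
    exact count_maximal_coprime K v fun h ↦ hv (h ▸ hw)
  | one => exact ⟨1, map_one _, fun v _ ↦ by rw [Units.val_one, count_one]⟩
  | mul a b _ _ ha hb =>
    obtain ⟨I, rfl, hI⟩ := ha
    obtain ⟨J, rfl, hJ⟩ := hb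
    refine ⟨I * J, map_mul _ _ _, fun v hv ↦ ?_⟩
    rw [count_units_mul, hI v hv, hJ v hv, add_zero]
  | inv a _ ha =>
    obtain ⟨I, rfl, hI⟩ := ha
    refine ⟨I⁻¹, map_inv _ _, fun v hv ↦ ?_⟩
    rw [count_units_inv, hI v hv, neg_zero]

end IsDedekindDomain

/-! ### Indices of squares, bounded by divisibility. -/

/-- The index of f(ker g) in the range of f divides the index of ker g. Divisibility stays
meaningful when cardinals are infinite and `Nat.card` is 0, so a nonzero bound later yields
finiteness. -/
theorem Subgroup.card_range_dvd_card_map_ker_mul {G A B : Type*} [Group G] [Group A] [Group B]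
    (f : G →* A) (g : G →* B) :
    Nat.card f.range ∣ Nat.card (g.ker.map f) * Nat.card g.range := by
  have h := Subgroup.index_map_dvd (H := g.ker) f.rangeRestrict_surjective
  rw [Subgroup.index_ker g] at h
  rw [← Subgroup.card_mul_index (g.ker.map f.rangeRestrict)]
  refine mul_dvd_mul (dvd_of_eq ?_) h
  have : g.ker.map f = (g.ker.map f.rangeRestrict).map f.range.subtype := by
    rw [Subgroup.map_map]; rfl
  rw [this, Nat.card_congr
    ((g.ker.map f.rangeRestrict).equivMapOfInjective _ f.range.subtype_injective).toEquiv]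

/-- The index of the subgroup of squares in a commutative group. -/
noncomputable def squareIndex (A : Type*) [CommGroup A] : ℕ :=
  (powMonoidHom 2 : A →* A).range.index

section squareIndex

variable {A B : Type*} [CommGroup A] [CommGroup B]

theorem squareIndex_eq_card (A : Type*) [CommGroup A] :
    squareIndex A = Nat.card (A ⧸ (powMonoidHom 2 : A →* A).range) := rfl

theorem squareIndex_dvd_of_surjective {f : A →* B} (hf : Function.Surjective f) :
    squareIndex B ∣ squareIndex A := by
  have : (powMonoidHom 2 : B →* B).range = (powMonoidHom 2 : A →* A).range.map f := by
    ext b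
    simp only [MonoidHom.mem_range, powMonoidHom_apply, Subgroup.mem_map]
    constructor
    · rintro ⟨c, rfl⟩
      obtain ⟨a, rfl⟩ := hf c
      exact ⟨a ^ 2, ⟨a, rfl⟩, map_pow f a 2⟩
    · rintro ⟨_, ⟨a, rfl⟩, rfl⟩
      exact ⟨f a, (map_pow f a 2).symm⟩
  rw [squareIndex, this]
  exact Subgroup.index_map_dvd _ hf

theorem card_map_mk_dvd_squareIndex (H : Subgroup A) :
    Nat.card (H.map (QuotientGroup.mk' (powMonoidHom 2 : A →* A).range)) ∣ squareIndex H := by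
  set f : H →* A ⧸ (powMonoidHom 2 : A →* A).range :=
    (QuotientGroup.mk' (powMonoidHom 2 : A →* A).range).comp H.subtype
  have hf : H.map (QuotientGroup.mk' (powMonoidHom 2 : A →* A).range) = f.range := by
    rw [MonoidHom.range_comp, Subgroup.range_subtype]
  rw [hf, ← Subgroup.index_ker f]
  refine Subgroup.index_dvd_of_le ?_
  rintro _ ⟨h, rfl⟩
  rw [MonoidHom.mem_ker]
  exact (QuotientGroup.eq_one_iff _).mpr ⟨h, rfl⟩

/-- Right exactness of A ↦ A/A²: if f(a) = f(c)², then a differs from an element of ker f by the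
square c². -/
theorem squareIndex_dvd_mul {f : A →* B} (hf : Function.Surjective f) :
    squareIndex A ∣ squareIndex f.ker * squareIndex B := by
  set s := (powMonoidHom 2 : A →* A).range
  set t := (powMonoidHom 2 : B →* B).range
  set g : A →* B ⧸ t := (QuotientGroup.mk' t).comp f
  have hg : Function.Surjective g := (QuotientGroup.mk'_surjective t).comp hf
  have h := Subgroup.card_range_dvd_card_map_ker_mul (QuotientGroup.mk' s) g
  have hker : g.ker.map (QuotientGroup.mk' s) = f.ker.map (QuotientGroup.mk' s) := by
    apply le_antisymm
    · rintro _ ⟨a, ha, rfl⟩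
      obtain ⟨b, hb⟩ := (QuotientGroup.eq_one_iff (f a)).mp ha
      obtain ⟨c, rfl⟩ := hf b
      refine ⟨a * (c ^ 2)⁻¹, ?_, ?_⟩
      · simp only [powMonoidHom_apply] at hb
        rw [SetLike.mem_coe, MonoidHom.mem_ker, map_mul, map_inv, map_pow, hb, mul_inv_cancel]
      · rw [map_mul, map_inv]
        have : QuotientGroup.mk' s (c ^ 2) = 1 := (QuotientGroup.eq_one_iff _).mpr ⟨c, rfl⟩
        rw [this, inv_one, mul_one]
    · refine Subgroup.map_mono fun a ha ↦ ?_
      rw [MonoidHom.mem_ker] at ha ⊢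
      change QuotientGroup.mk' t (f a) = 1
      rw [ha, map_one]
  rw [hker, MonoidHom.range_eq_top.mpr hg, MonoidHom.range_eq_top.mpr
    (QuotientGroup.mk'_surjective s), Subgroup.card_top, Subgroup.card_top,
    ← squareIndex_eq_card, ← squareIndex_eq_card] at h
  exact h.trans (mul_dvd_mul_right (card_map_mk_dvd_squareIndex f.ker) _)

theorem squareIndex_dvd_two_of_isCyclic (A : Type*) [CommGroup A] [IsCyclic A] :
    squareIndex A ∣ 2 := by
  have := isCyclic_of_surjective _
    (QuotientGroup.mk'_surjective (powMonoidHom 2 : A →* A).range)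
  rw [squareIndex_eq_card, ← IsCyclic.exponent_eq_card, Monoid.exponent_dvd_iff_forall_pow_eq_one]
  intro g
  obtain ⟨a, rfl⟩ := QuotientGroup.mk'_surjective _ g
  exact (QuotientGroup.eq_one_iff _).mpr ⟨a, rfl⟩

theorem squareIndex_dvd_of_isCyclic [IsCyclic B] (f : A →* B) :
    squareIndex A ∣ squareIndex f.ker * 2 := by
  have h := squareIndex_dvd_mul f.rangeRestrict_surjective
  rw [MonoidHom.ker_rangeRestrict] at h
  exact h.trans (mul_dvd_mul_left _ (squareIndex_dvd_two_of_isCyclic _))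

end squareIndex

/-! ### The 2-Selmer group of the field. -/

namespace IsDedekindDomain

open FractionalIdeal TwinPrimeCurve

variable {R : Type*} [CommRing R] [IsDedekindDomain R] {K : Type*} [Field K] [Algebra R K]
  [IsFractionRing R K] {S : Set (HeightOneSpectrum R)}

variable (S K) in
/-- The elements of `Kˣ` of even valuation outside `S`; its image in `Kˣ` modulo squares is the
`2`-Selmer group of `K`. -/
def evenOutside : Subgroup Kˣ where
  carrier := {x | ∀ v ∉ S, Even (v.valuationOfNeZero x).toAdd}
  one_mem' v _ := by simp
  mul_mem' hx hy v hv := by rw [map_mul, toAdd_mul]; exact (hx v hv).add (hy v hv)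
  inv_mem' hx v hv := by rw [map_inv, toAdd_inv]; exact (hx v hv).neg

variable (S K) in
/-- Pairs `(x, I)` such that the ideal `(x)` is the square of `I` away from `S`. -/
def squareRootPairs : Subgroup (Kˣ × (FractionalIdeal R⁰ K)ˣ) where
  carrier := {p | ∀ v ∉ S, count K v (spanSingleton R⁰ (p.1 : K)) =
    2 * count K v (p.2 : FractionalIdeal R⁰ K)}
  one_mem' v _ := by simp [count_one]
  mul_mem' {p q} hp hq v hv := by
    simp only [Set.mem_ofPred_eq, HeightOneSpectrum.count_spanSingleton] at hp hq ⊢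
    rw [Prod.snd_mul, count_units_mul, mul_add, ← hp v hv, ← hq v hv, Prod.fst_mul, map_mul,
      toAdd_mul]
    ring
  inv_mem' {p} hp v hv := by
    simp only [Set.mem_ofPred_eq, HeightOneSpectrum.count_spanSingleton] at hp ⊢
    rw [Prod.snd_inv, count_units_inv, mul_neg, ← hp v hv, Prod.fst_inv, map_inv, toAdd_inv]

theorem mem_squareRootPairs {p : Kˣ × (FractionalIdeal R⁰ K)ˣ} :
    p ∈ squareRootPairs K S ↔ ∀ v ∉ S, count K v (spanSingleton R⁰ (p.1 : K)) =
      2 * count K v (p.2 : FractionalIdeal R⁰ K) := Iff.rfl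

theorem exists_mem_squareRootPairs {x : Kˣ} (hx : x ∈ evenOutside K S) :
    ∃ I, (x, I) ∈ squareRootPairs K S := by
  -- The division may round at places of S, where no condition is imposed.
  set e : HeightOneSpectrum R → ℤ := fun v ↦ count K v (spanSingleton R⁰ (x : K)) / 2
  have he : ∀ᶠ v : HeightOneSpectrum R in Filter.cofinite, e v = 0 := by
    filter_upwards [finite_factors (spanSingleton R⁰ (x : K))] with v hv
    simp [e, hv]
  have hne : ∏ᶠ v : HeightOneSpectrum R, (v.asIdeal : FractionalIdeal R⁰ K) ^ e v ≠ 0 :=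
    finprod_induction (· ≠ 0) one_ne_zero (fun _ _ ↦ mul_ne_zero)
      fun v ↦ zpow_ne_zero _ (coeIdeal_ne_zero.mpr v.ne_bot)
  refine ⟨Units.mk0 _ hne, fun v hv ↦ ?_⟩
  rw [Units.val_mk0, count_finprod K v e he, Int.mul_ediv_cancel']
  rw [HeightOneSpectrum.count_spanSingleton, dvd_neg]
  exact (hx v hv).two_dvd

theorem exists_toPrincipalIdeal_eq_of_mk_eq_one {I : (FractionalIdeal R⁰ K)ˣ}
    (hI : ClassGroup.mk K I = 1) : ∃ y : Kˣ, toPrincipalIdeal R K y = I := by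
  obtain ⟨y, hy⟩ := ClassGroup.mk_eq_one_iff.mp hI
  refine mem_principal_ideals_iff.mpr ⟨y, ?_⟩
  exact Subtype.coe_injective (by simp [hy, coe_spanSingleton])

/-- The `2`-Selmer group of `K` outside `S` is an extension of a subgroup of the `2`-torsion of
the `S`-class group by the `S`-units modulo squares. -/
theorem card_evenOutside_dvd :
    Nat.card ((evenOutside K S).map (QuotientGroup.mk' (powMonoidHom 2 : Kˣ →* Kˣ).range)) ∣
      squareIndex (S.unit K) *
        Nat.card (powMonoidHom 2 : SClassGroup R S →* SClassGroup R S).ker := by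
  set f : squareRootPairs K S →* Kˣ ⧸ (powMonoidHom 2 : Kˣ →* Kˣ).range :=
    (QuotientGroup.mk' _).comp ((MonoidHom.fst _ _).comp (squareRootPairs K S).subtype)
  set g : squareRootPairs K S →* SClassGroup R S :=
    (QuotientGroup.mk' _).comp ((ClassGroup.mk K).comp
      ((MonoidHom.snd _ _).comp (squareRootPairs K S).subtype))
  have hgker (p : squareRootPairs K S) : g p = 1 ↔ ClassGroup.mk K p.1.2 ∈ Subgroup.closure
      {c : ClassGroup R | ∃ v ∈ S,
        c = ClassGroup.mk0 ⟨v.asIdeal, mem_nonZeroDivisors_of_ne_zero v.ne_bot⟩} :=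
    QuotientGroup.eq_one_iff _
  have h₁ : (evenOutside K S).map (QuotientGroup.mk' _) ≤ f.range := by
    rintro _ ⟨x, hx, rfl⟩
    obtain ⟨I, hI⟩ := exists_mem_squareRootPairs hx
    exact ⟨⟨_, hI⟩, rfl⟩
  -- I² equals (x) up to primes of S, so the S-class of I is 2-torsion.
  have h₂ : g.range ≤ (powMonoidHom 2).ker := by
    rintro _ ⟨⟨⟨x, I⟩, hp⟩, rfl⟩
    rw [MonoidHom.mem_ker, powMonoidHom_apply, ← map_pow, hgker]
    change ClassGroup.mk K (I ^ 2) ∈ _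
    have hx : ClassGroup.mk K (toPrincipalIdeal R K x) = 1 := by
      rw [ClassGroup.mk_eq_one_iff]
      exact ⟨x, by simp⟩
    have : ClassGroup.mk K (I ^ 2) = ClassGroup.mk K (I * I * (toPrincipalIdeal R K x)⁻¹) := by
      rw [map_mul, map_inv, hx, inv_one, mul_one, sq]
    rw [this]
    refine mk_mem_closure_of_count_eq_zero fun v hv ↦ ?_
    rw [count_units_mul, count_units_mul, count_units_inv, coe_toPrincipalIdeal,
      mem_squareRootPairs.mp hp v hv]
    ring
  -- If I = (y)J with J supported on S, then x/y² is an S-unit in the square class of x.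
  have h₃ : g.ker.map f ≤ (S.unit K).map (QuotientGroup.mk' _) := by
    rintro _ ⟨⟨⟨x, I⟩, hp⟩, hg, rfl⟩
    rw [SetLike.mem_coe, MonoidHom.mem_ker, hgker] at hg
    obtain ⟨J, hJ, hJS⟩ := exists_mk_eq_of_mem_closure K hg
    have hIJ : ClassGroup.mk K (I * J⁻¹) = 1 := by rw [map_mul, map_inv, hJ, mul_inv_cancel]
    obtain ⟨y, hy⟩ := exists_toPrincipalIdeal_eq_of_mk_eq_one hIJ
    refine ⟨x * (y ^ 2)⁻¹, ?_, ?_⟩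
    · refine (mem_unit_iff _).mpr fun v hv ↦ ?_
      have hyv := congrArg (fun I : (FractionalIdeal R⁰ K)ˣ ↦ count K v I.1) hy
      have hxv := mem_squareRootPairs.mp hp v hv
      simp only [coe_toPrincipalIdeal, count_units_mul, count_units_inv, hJS v hv,
        HeightOneSpectrum.count_spanSingleton] at hyv hxv
      rw [← toAdd_eq_zero, map_mul, map_inv, map_pow, toAdd_mul, toAdd_inv, toAdd_pow]
      simp only [nsmul_eq_mul, Nat.cast_ofNat]
      linarith
    · have : QuotientGroup.mk' (powMonoidHom 2 : Kˣ →* Kˣ).range (y ^ 2) = 1 :=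
        (QuotientGroup.eq_one_iff _).mpr ⟨y, rfl⟩
      rw [map_mul, map_inv, this, inv_one]
      exact mul_one (f ⟨(x, I), hp⟩)
  exact (Subgroup.card_dvd_of_le h₁).trans <| (Subgroup.card_range_dvd_card_map_ker_mul f g).trans
    <| mul_dvd_mul ((Subgroup.card_dvd_of_le h₃).trans (card_map_mk_dvd_squareIndex _))
      (Subgroup.card_dvd_of_le h₂)

end IsDedekindDomain

/-! ### Units and S-units modulo squares. -/

theorem squareIndex_multiplicative_finsupp (ι : Type*) [Finite ι] :
    squareIndex (Multiplicative (ι →₀ ℤ)) = 2 ^ Nat.card ι := by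
  have := Fintype.ofFinite ι
  set f : (ι →₀ ℤ) →+ (ι → ZMod 2) :=
    { toFun := fun a i ↦ (a i : ZMod 2)
      map_zero' := by ext; simp
      map_add' := fun a b ↦ by ext; simp }
  have hf : Function.Surjective f.toMultiplicative := fun b ↦ by
    refine ⟨.ofAdd (Finsupp.equivFunOnFinite.symm fun i ↦ ((b.toAdd i).cast : ℤ)), ?_⟩
    refine congrArg Multiplicative.ofAdd (funext fun i ↦ ?_)
    change (((b.toAdd i).cast : ℤ) : ZMod 2) = b.toAdd i
    simp
  have hker : f.toMultiplicative.ker = (powMonoidHom 2).range := by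
    ext a
    rw [MonoidHom.mem_ker, MonoidHom.mem_range]
    constructor
    · intro ha
      have ha' (i : ι) : (2 : ℤ) ∣ a.toAdd i :=
        (ZMod.intCast_zmod_eq_zero_iff_dvd _ 2).mp (congrFun (congrArg Multiplicative.toAdd ha) i)
      choose c hc using ha'
      refine ⟨.ofAdd (Finsupp.equivFunOnFinite.symm c), ?_⟩
      refine congrArg Multiplicative.ofAdd (Finsupp.ext (f := 2 • Finsupp.equivFunOnFinite.symm c)
        (g := a.toAdd) fun i ↦ ?_)
      rw [hc i]
      simp
    · rintro ⟨c, rfl⟩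
      refine congrArg Multiplicative.ofAdd (funext fun i ↦ ?_)
      change (((2 • c.toAdd) i : ℤ) : ZMod 2) = 0
      rw [Finsupp.smul_apply, nsmul_eq_mul, Int.cast_mul]
      exact mul_eq_zero_of_left (by decide) _
  rw [squareIndex, ← hker, Subgroup.index_ker, MonoidHom.range_eq_top.mpr hf, Subgroup.card_top,
    Nat.card_congr Multiplicative.toAdd, Nat.card_fun, Nat.card_zmod]

namespace NumberField

variable (K : Type*) [Field K] [NumberField K]

-- Dirichlet: the free part contributes the unit rank, and the cyclic group of roots of unity at
-- most one more factor 2.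
set_option maxSynthPendingDepth 5 in
theorem squareIndex_units_dvd : squareIndex (𝓞 K)ˣ ∣ 2 ^ (Units.rank K + 1) := by
  have h := squareIndex_dvd_mul (A := (𝓞 K)ˣ) (B := (𝓞 K)ˣ ⧸ Units.torsion K)
    (f := QuotientGroup.mk' (Units.torsion K)) (QuotientGroup.mk'_surjective _)
  rw [QuotientGroup.ker_mk'] at h
  set e := (Units.basisModTorsion K).repr.symm.toAddEquiv
  have he : Function.Surjective (AddMonoidHom.toMultiplicativeLeft e.toAddMonoidHom) :=
    e.surjective
  have h' := squareIndex_dvd_of_surjective he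
  rw [squareIndex_multiplicative_finsupp, Nat.card_fin] at h'
  rw [pow_succ, mul_comm]
  exact h.trans (mul_dvd_mul (squareIndex_dvd_two_of_isCyclic _) h')

theorem Units.rank_lt_finrank : Units.rank K < Module.finrank ℚ K := by
  have h₁ := InfinitePlace.card_eq_nrRealPlaces_add_nrComplexPlaces K
  have h₂ := InfinitePlace.card_add_two_mul_card_eq_rank K
  have h₃ : 0 < Module.finrank ℚ K := Module.finrank_pos
  rw [Units.rank]
  omega

end NumberField

namespace IsDedekindDomain

variable {R : Type*} [CommRing R] [IsDedekindDomain R] (K : Type*) [Field K] [Algebra R K]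
  [IsFractionRing R K]

theorem squareIndex_unit_empty_dvd :
    squareIndex ((∅ : Set (HeightOneSpectrum R)).unit K) ∣ squareIndex Rˣ := by
  set f : Rˣ →* (∅ : Set (HeightOneSpectrum R)).unit K :=
    (Units.map (algebraMap R K : R →* K)).codRestrict _ fun x ↦
      (mem_unit_iff _).mpr fun v _ ↦ v.valuation_of_unit_eq x
  refine squareIndex_dvd_of_surjective (f := f) ?_
  rintro ⟨x, hx⟩
  rw [mem_unit_iff] at hx
  have key (y : Kˣ) (hy : ∀ v : HeightOneSpectrum R, v.valuationOfNeZero y = 1) :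
      ∃ r : R, algebraMap R K r = y :=
    HeightOneSpectrum.mem_integers_of_valuation_le_one K (y : K) fun v ↦ by
      rw [← HeightOneSpectrum.valuationOfNeZero_eq, hy v]; exact le_rfl
  obtain ⟨a, ha⟩ := key x fun v ↦ hx v (Set.notMem_empty v)
  obtain ⟨b, hb⟩ := key x⁻¹ fun v ↦ by rw [map_inv, hx v (Set.notMem_empty v), inv_one]
  have hab : a * b = 1 := IsFractionRing.injective R K (by rw [map_mul, ha, hb]; simp)
  exact ⟨⟨a, b, hab, by rwa [mul_comm]⟩, Subtype.ext (Units.ext ha)⟩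

/-- The valuation at w maps the larger group to ℤ with kernel the S-units, so each new prime costs
at most one factor 2. -/
theorem squareIndex_unit_insert_dvd (S : Set (HeightOneSpectrum R)) {w : HeightOneSpectrum R}
    (hw : w ∉ S) : squareIndex ((insert w S).unit K) ∣ squareIndex (S.unit K) * 2 := by
  set f : (insert w S).unit K →* Multiplicative ℤ :=
    w.valuationOfNeZero.comp ((insert w S).unit K).subtype
  refine (squareIndex_dvd_of_isCyclic f).trans (mul_dvd_mul_right ?_ 2)
  have hle : S.unit K ≤ (insert w S).unit K := fun x hx ↦ by
    rw [mem_unit_iff] at hx ⊢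
    exact fun v hv ↦ hx v fun h ↦ hv (Set.mem_insert_of_mem _ h)
  set g : S.unit K →* f.ker :=
    (Subgroup.inclusion hle).codRestrict _ fun x ↦ (mem_unit_iff _).mp x.2 w hw
  refine squareIndex_dvd_of_surjective (f := g) ?_
  rintro ⟨⟨x, hx⟩, hxf⟩
  refine ⟨⟨x, ?_⟩, rfl⟩
  rw [mem_unit_iff] at hx ⊢
  intro v hv
  by_cases hvw : v = w
  · rw [hvw]; exact hxf
  · exact hx v fun h ↦ (Set.mem_insert_iff.mp h).elim hvw hv

theorem squareIndex_unit_dvd {S : Set (HeightOneSpectrum R)} (hS : S.Finite) :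
    squareIndex (S.unit K) ∣ squareIndex Rˣ * 2 ^ S.ncard := by
  induction S, hS using Set.Finite.induction_on with
  | empty => simpa using squareIndex_unit_empty_dvd K
  | @insert w S hw hS ih =>
    rw [Set.ncard_insert_of_notMem hw hS, pow_succ, ← mul_assoc]
    exact (squareIndex_unit_insert_dvd K S hw).trans (mul_dvd_mul_right ih 2)

end IsDedekindDomain

/-! ### Places above a rational prime. -/

namespace TwinPrimeCurve

open NumberField

variable (K : Type*) [Field K] [NumberField K]

/-- In ∑ e f = [K : ℚ] every prime above l contributes at least 1. -/
theorem placesDividing_finite_and_ncard_le {l : ℕ} (hl : l.Prime) :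
    (placesDividing K l).Finite ∧ (placesDividing K l).ncard ≤ Module.finrank ℚ K := by
  set I : Ideal ℤ := Ideal.span {(l : ℤ)}
  have hprime : Prime (l : ℤ) := Nat.prime_iff_prime_int.mp hl
  have hI : I ≠ ⊥ := by simpa [I, Ideal.span_singleton_eq_bot] using hl.ne_zero
  have : I.IsPrime := (Ideal.span_singleton_prime hprime.ne_zero).mpr hprime
  have hmax : I.IsMaximal := this.isMaximal hI
  have hfin : (I.primesOver (𝓞 K)).Finite := IsDedekindDomain.primesOver_finite I (𝓞 K)
  have hcard : (I.primesOver (𝓞 K)).ncard ≤ Module.finrank ℚ K := by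
    have := hfin.fintype
    rw [← RingOfIntegers.rank K, ← Ideal.sum_ramification_inertia_eq_finrank (p := I),
      ← Nat.card_coe_set_eq, Nat.card_eq_fintype_card, Fintype.card_eq_sum_ones]
    refine Finset.sum_le_sum fun P _ ↦ ?_
    have : P.1.IsPrime := P.2.1
    have : P.1.LiesOver I := P.2.2
    exact Nat.one_le_iff_ne_zero.mpr (mul_ne_zero (P.1.ramificationIdx_pos ℤ).ne'
      (P.1.inertiaDeg_pos ℤ).ne')
  have himg : HeightOneSpectrum.asIdeal '' placesDividing K l ⊆ I.primesOver (𝓞 K) := by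
    rintro _ ⟨v, hv, rfl⟩
    refine ⟨v.isPrime, ⟨hmax.eq_of_le (Ideal.comap_ne_top _ v.isPrime.ne_top) ?_⟩⟩
    rw [Ideal.span_singleton_le_iff_mem, Ideal.mem_comap]
    simpa [placesDividing] using hv
  have hinj : Set.InjOn HeightOneSpectrum.asIdeal (placesDividing K l) :=
    fun v _ w _ h ↦ HeightOneSpectrum.ext h
  refine ⟨(hfin.subset himg).of_finite_image hinj, ?_⟩
  rw [← hinj.ncard_image]
  exact (Set.ncard_le_ncard himg hfin).trans hcard

theorem placesDividing_mul (a b : ℕ) :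
    placesDividing K (a * b) = placesDividing K a ∪ placesDividing K b := by
  ext v
  simp only [placesDividing, Set.mem_ofPred_eq, Set.mem_union, Nat.cast_mul]
  exact v.isPrime.mul_mem_iff_mem_or_mem

end TwinPrimeCurve

/-! ### From the index of doubling to the rank. -/

theorem Subgroup.index_dvd_card_sq_of_ker_inf_ker_le {G Q : Type*} [Group G] [Group Q]
    {f g : G →* Q} {H : Subgroup Q} (hf : ∀ x, f x ∈ H) (hg : ∀ x, g x ∈ H) {N : Subgroup G}
    (hN : f.ker ⊓ g.ker ≤ N) : N.index ∣ Nat.card H ^ 2 := by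
  have hrange : (f.prod g).range ≤ H.prod H := by
    rintro _ ⟨x, rfl⟩
    exact ⟨hf x, hg x⟩
  rw [← MonoidHom.ker_prod] at hN
  refine (Subgroup.index_dvd_of_le hN).trans ?_
  rw [Subgroup.index_ker, sq, ← Nat.card_prod, ← Nat.card_congr (H.prodEquiv H).toEquiv]
  exact Subgroup.card_dvd_of_le hrange

section squareIndex

variable {A B : Type*} [CommGroup A] [CommGroup B]

theorem squareIndex_congr (e : A ≃* B) : squareIndex A = squareIndex B :=
  Nat.dvd_antisymm (squareIndex_dvd_of_surjective (f := e.symm.toMonoidHom) e.symm.surjective)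
    (squareIndex_dvd_of_surjective (f := e.toMonoidHom) e.surjective)

theorem squareIndex_prod : squareIndex (A × B) = squareIndex A * squareIndex B := by
  rw [squareIndex, squareIndex, squareIndex, ← Subgroup.index_prod]
  congr 1
  ext ⟨a, b⟩
  simp only [MonoidHom.mem_range, Subgroup.mem_prod, powMonoidHom_apply, Prod.exists, Prod.pow_mk,
    Prod.mk.injEq]
  exact ⟨fun ⟨c, d, h⟩ ↦ ⟨⟨c, h.1⟩, d, h.2⟩, fun ⟨⟨c, hc⟩, d, hd⟩ ↦ ⟨c, d, hc, hd⟩⟩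

theorem squareIndex_eq_card_ker [Finite A] :
    squareIndex A = Nat.card (powMonoidHom 2 : A →* A).ker := by
  have h₁ := Subgroup.card_mul_index (powMonoidHom 2 : A →* A).ker
  rw [Subgroup.index_ker, ← Subgroup.card_mul_index (powMonoidHom 2 : A →* A).range, mul_comm] at h₁
  exact (Nat.eq_of_mul_eq_mul_left Nat.card_pos h₁).symm

theorem squareIndex_multiplicative_of_addEquiv {A B : Type*} [AddCommGroup A] [AddCommGroup B]
    [Finite B] {n : ℕ} (e : A ≃+ (Fin n →₀ ℤ) × B) :
    squareIndex (Multiplicative A) =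
      2 ^ Module.finrank ℤ A * Nat.card {a : A // 2 • a = 0} := by
  have hrank : Module.finrank ℤ A = n := by
    have hle : (LinearMap.fst ℤ (Fin n →₀ ℤ) B).ker ≤
        Submodule.torsion ℤ ((Fin n →₀ ℤ) × B) := by
      rintro ⟨a, b⟩ (rfl : a = 0)
      refine ⟨⟨(Nat.card B : ℤ), mem_nonZeroDivisors_of_ne_zero
        (by exact_mod_cast Nat.card_pos.ne')⟩, ?_⟩
      change (Nat.card B : ℤ) • ((0 : Fin n →₀ ℤ), b) = 0
      rw [natCast_zsmul, Prod.smul_mk, card_nsmul_eq_zero', smul_zero]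
      rfl
    rw [e.toIntLinearEquiv.finrank_eq, ← finrank_quotient_eq_of_le_torsion hle,
      ((LinearMap.fst ℤ (Fin n →₀ ℤ) B).quotKerEquivOfSurjective
        LinearMap.fst_surjective).finrank_eq]
    exact (Module.finrank_finsupp_self ℤ).trans (Fintype.card_fin n)
  have htor : Nat.card {a : A // 2 • a = 0} =
      Nat.card (powMonoidHom 2 : Multiplicative B →* Multiplicative B).ker := by
    refine Nat.card_congr ⟨fun a ↦ ⟨.ofAdd (e a.1).2, ?_⟩,
      fun b ↦ ⟨e.symm (0, b.1.toAdd), ?_⟩, fun a ↦ Subtype.ext ?_, fun b ↦ Subtype.ext ?_⟩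
    · have h : 2 • (e a.1).2 = 0 := by simpa using congrArg (fun a ↦ (e a).2) a.2
      exact h
    · have : 2 • b.1.toAdd = 0 := b.2
      rw [← map_nsmul, Prod.smul_mk, this, smul_zero]
      exact map_zero e.symm
    · have h : 2 • (e a.1).1 = 0 := by simpa using congrArg (fun a ↦ (e a).1) a.2
      have h0 : (e a.1).1 = 0 := (smul_eq_zero_iff_right two_ne_zero).mp h
      simp [← h0]
    · simp
  rw [hrank, htor, squareIndex_congr ((AddEquiv.toMultiplicative e).trans
      (MulEquiv.prodMultiplicative _ _)),
    squareIndex_prod, squareIndex_multiplicative_finsupp, Nat.card_fin, squareIndex_eq_card_ker]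

/-- In a finitely generated abelian group `A` of rank `r`, the index of `2A` is `2 ^ r` times the
order of the `2`-torsion. -/
theorem squareIndex_multiplicative_of_fg (A : Type*) [AddCommGroup A] [AddGroup.FG A] :
    squareIndex (Multiplicative A) =
      2 ^ Module.finrank ℤ A * Nat.card {a : A // 2 • a = 0} := by
  obtain ⟨n, ι, _, p, hp, m, ⟨e⟩⟩ := AddCommGroup.equiv_free_prod_directSum_zmod A
  have (i : ι) : NeZero (p i ^ m i) := ⟨pow_ne_zero _ (hp i).ne_zero⟩
  have : Finite (DirectSum ι fun i ↦ ZMod (p i ^ m i)) :=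
    Finite.of_equiv _ (DirectSum.addEquivProd fun i ↦ ZMod (p i ^ m i)).symm.toEquiv
  exact squareIndex_multiplicative_of_addEquiv e

end squareIndex

/-! ### The rank bound over a number field. -/

namespace WeierstrassCurve.Affine.Point

open TwinPrimeCurve

section

variable {F : Type*} [Field F] [DecidableEq F] {W : WeierstrassCurve F} {e₁ e₂ e₃ : F}

theorem squareIndex_dvd_of_descentMap_mem (h : W.IsSplit e₁ e₂ e₃) (h2 : (2 : F) ≠ 0)
    {H : Subgroup (Fˣ ⧸ (powMonoidHom 2 : Fˣ →* Fˣ).range)}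
    (hH : ∀ P, descentMap h P ∈ H) (hH' : ∀ P, descentMap h.rotate P ∈ H) :
    squareIndex (Multiplicative W.toAffine.Point) ∣ Nat.card H ^ 2 := by
  refine Subgroup.index_dvd_card_sq_of_ker_inf_ker_le hH hH' fun P hP ↦ ?_
  obtain ⟨Q, hQ⟩ := exists_add_self_eq_of_isSquare h h2 P.toAdd
    (isSquare_descentValue_of_descentMap_eq_one h hP.1)
    (isSquare_descentValue_of_descentMap_eq_one h.rotate hP.2)
  refine ⟨.ofAdd Q, ?_⟩
  rw [powMonoidHom_apply, sq, ← ofAdd_add, hQ, ofAdd_toAdd]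

/-- The four points are 0 and (eᵢ, 0). Finiteness is needed because `Nat.card` of an infinite type
is 0. -/
theorem four_le_card_two_torsion (h : W.IsSplit e₁ e₂ e₃) (h2 : (2 : F) ≠ 0)
    [Finite {P : W.toAffine.Point // 2 • P = 0}] :
    4 ≤ Nat.card {P : W.toAffine.Point // 2 • P = 0} := by
  have := h.isElliptic h2
  have hns (e : F) (he : (e - e₁) * (e - e₂) * (e - e₃) = 0) : W.toAffine.Nonsingular e 0 :=
    Affine.equation_iff_nonsingular.mp ((h.equation_iff e 0).mpr (by rw [he]; ring))
  have htor (e : F) (he : (e - e₁) * (e - e₂) * (e - e₃) = 0) :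
      2 • Point.some e 0 (hns e he) = 0 := by
    rw [two_nsmul, add_self_of_Y_eq (by rw [h.negY_eq, _root_.neg_zero])]
  set T : Option (Fin 3) → {P : W.toAffine.Point // 2 • P = 0} := fun i ↦ i.elim ⟨0, smul_zero 2⟩
    ![⟨_, htor e₁ (by ring)⟩, ⟨_, htor e₂ (by ring)⟩, ⟨_, htor e₃ (by ring)⟩]
  have hT : Function.Injective T := by
    have n₁₂ := h.ne₁₂
    have n₁₃ := h.ne₁₃
    have n₂₃ := h.ne₂₃
    intro i j hij
    rcases i with _ | i <;> rcases j with _ | j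
    · rfl
    · fin_cases j <;> simp [T] at hij
    · fin_cases i <;> simp [T] at hij
    · fin_cases i <;> fin_cases j <;> simp_all [T]
  simpa using Nat.card_le_card_of_injective T hT

end

section

variable {K : Type*} [Field K] [NumberField K] [DecidableEq K] {W : WeierstrassCurve K}
  {e₁ e₂ e₃ : K} {S : Set (HeightOneSpectrum (𝓞 K))}

theorem descentMap_mem_map_evenOutside (h : W.IsSplit e₁ e₂ e₃)
    (h₁₂ : ∀ v ∉ S, v.valuation K (e₁ - e₂) = 1) (h₁₃ : ∀ v ∉ S, v.valuation K (e₁ - e₃) = 1)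
    (P : Multiplicative W.toAffine.Point) :
    descentMap h P ∈ (evenOutside K S).map (QuotientGroup.mk' _) := by
  refine ⟨_, fun v hv ↦ ?_, rfl⟩
  obtain ⟨r, hr⟩ :=
    isSquare_valuation_descentValue (v.valuation K) h (h₁₂ v hv) (h₁₃ v hv) P.toAdd
  set u := Units.mk0 _ (descentValue_ne_zero h P.toAdd)
  have hu : v.valuation K (u : K) = r * r := hr
  rw [← HeightOneSpectrum.valuationOfNeZero_eq] at hu
  have hr0 : r ≠ 0 := by
    rintro rfl
    simp at hu
  obtain ⟨s, rfl⟩ := WithZero.ne_zero_iff_exists.mp hr0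
  rw [← WithZero.coe_mul, WithZero.coe_inj] at hu
  rw [hu, toAdd_mul]
  exact ⟨_, rfl⟩

theorem card_ker_eq_two_pow_dimTwoTorsion (A : Type*) [CommGroup A] [Finite A] :
    Nat.card (powMonoidHom 2 : A →* A).ker = 2 ^ dimTwoTorsion (Additive A) := by
  let _ : Module (ZMod 2) (AddSubgroup.torsionBy (Additive A) ((2 : ℕ) : ℤ)) :=
    AddSubgroup.torsionBy.zmodModule
  have h := Module.natCard_eq_pow_finrank (K := ZMod 2)
    (V := AddSubgroup.torsionBy (Additive A) ((2 : ℕ) : ℤ))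
  rw [Nat.card_zmod] at h
  rw [dimTwoTorsion, ← h]
  refine Nat.card_congr (Additive.ofMul.subtypeEquiv fun a ↦ ?_)
  rw [MonoidHom.mem_ker, powMonoidHom_apply, ← ofMul_eq_zero, ofMul_pow, ← natCast_zsmul]
  exact (Submodule.mem_torsionBy_iff (R := ℤ) _ _).symm

/-- The Mordell-Weil theorem with an explicit rank bound, for an elliptic curve with full rational
`2`-torsion over a number field. -/
theorem finite_and_finrank_add_two_le (h : W.IsSplit e₁ e₂ e₃) (hS : S.Finite)
    (h₁₂ : ∀ v ∉ S, v.valuation K (e₁ - e₂) = 1) (h₁₃ : ∀ v ∉ S, v.valuation K (e₁ - e₃) = 1)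
    (h₂₃ : ∀ v ∉ S, v.valuation K (e₂ - e₃) = 1) :
    Module.Finite ℤ W.toAffine.Point ∧ Module.finrank ℤ W.toAffine.Point + 2 ≤
      2 * (NumberField.Units.rank K + 1 + S.ncard +
        dimTwoTorsion (Additive (SClassGroup (𝓞 K) S))) := by
  have h2 : (2 : K) ≠ 0 := two_ne_zero
  have := h.isElliptic h2
  have hdvd : squareIndex (Multiplicative W.toAffine.Point) ∣
      2 ^ (2 * (NumberField.Units.rank K + 1 + S.ncard +
        dimTwoTorsion (Additive (SClassGroup (𝓞 K) S)))) := by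
    refine (squareIndex_dvd_of_descentMap_mem h h2
      (descentMap_mem_map_evenOutside h h₁₂ h₁₃)
      (descentMap_mem_map_evenOutside h.rotate h₂₃ fun v hv ↦ ?_)).trans ?_
    · rw [Valuation.map_sub_swap, h₁₂ v hv]
    rw [mul_comm 2, pow_mul, pow_add, pow_add]
    refine pow_dvd_pow_of_dvd (card_evenOutside_dvd.trans (mul_dvd_mul ?_ ?_)) 2
    · exact (squareIndex_unit_dvd K hS).trans
        (mul_dvd_mul_right (NumberField.squareIndex_units_dvd K) _)
    · rw [card_ker_eq_two_pow_dimTwoTorsion]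
  -- A divisor of a power of 2 is nonzero, so the index is finite: this is weak Mordell-Weil.
  have hne : squareIndex (Multiplicative W.toAffine.Point) ≠ 0 :=
    fun h0 ↦ by simp [h0] at hdvd
  have hfg : AddGroup.FG W.toAffine.Point := fg_of_finiteIndex_two ⟨hne⟩
  refine ⟨Module.Finite.iff_addGroup_fg.mpr hfg, ?_⟩
  rw [squareIndex_multiplicative_of_fg] at hdvd hne
  have : Finite {P : W.toAffine.Point // 2 • P = 0} :=
    Nat.finite_of_card_ne_zero (right_ne_zero_of_mul hne)
  have hle := (Nat.mul_le_mul_left _ (four_le_card_two_torsion h h2)).trans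
    (Nat.le_of_dvd (by positivity) hdvd)
  rw [show 4 = 2 ^ 2 from rfl, ← pow_add] at hle
  exact (Nat.pow_le_pow_iff_right one_lt_two).mp hle

end

end WeierstrassCurve.Affine.Point

/-! ### The twin prime curve over K. -/

namespace TwinPrimeCurve

variable {K : Type*} [Field K] [NumberField K]

theorem valuation_natCast_eq_one {m n : ℕ} (hn : n ∣ m) {v : HeightOneSpectrum (𝓞 K)}
    (hv : v ∉ placesDividing K m) : v.valuation K (n : K) = 1 := by
  rw [← map_natCast (algebraMap (𝓞 K) K), HeightOneSpectrum.valuation_eq_one_iff_notMem]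
  exact fun h ↦ hv (Ideal.mem_of_dvd _ (Nat.cast_dvd_cast hn) h)

theorem placesDividing_two_mul_mul_finite_and_ncard_le {p q : ℕ} (hp : p.Prime) (hq : q.Prime) :
    (placesDividing K (2 * p * q)).Finite ∧
      (placesDividing K (2 * p * q)).ncard ≤ 3 * Module.finrank ℚ K := by
  obtain ⟨h₂, h₂'⟩ := placesDividing_finite_and_ncard_le K Nat.prime_two
  obtain ⟨hp, hp'⟩ := placesDividing_finite_and_ncard_le K hp
  obtain ⟨hq, hq'⟩ := placesDividing_finite_and_ncard_le K hq
  rw [placesDividing_mul, placesDividing_mul]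
  refine ⟨(h₂.union hp).union hq, ?_⟩
  have := Set.ncard_union_le (placesDividing K 2 ∪ placesDividing K p) (placesDividing K q)
  have := Set.ncard_union_le (placesDividing K 2) (placesDividing K p)
  omega

/-- The minimal polynomial of α divides X² - D; only this upper bound on the degree is needed. -/
theorem finrank_le_two_of_adjoin_sqrt {α : K} {D : ℕ} (hα : α ^ 2 = (D : K))
    (hK : IntermediateField.adjoin ℚ {α} = ⊤) : Module.finrank ℚ K ≤ 2 := by
  have hint : IsIntegral ℚ α := Algebra.IsIntegral.isIntegral α
  rw [← IntermediateField.finrank_top', ← hK, IntermediateField.adjoin.finrank hint]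
  have hmon : (Polynomial.X ^ 2 - Polynomial.C (D : ℚ)).Monic :=
    Polynomial.monic_X_pow_sub_C _ two_ne_zero
  refine (Polynomial.natDegree_le_of_dvd (minpoly.dvd ℚ α ?_) hmon.ne_zero).trans
    (Polynomial.natDegree_X_pow_sub_C).le
  simp [hα]

theorem isSplit_curve {p q : ℕ} (hp : p ≠ 0) (hq : q ≠ 0) (hpq : p ≠ q) {ε : ℤ} (hε : ε ≠ 0) :
    ((curve ε p q).baseChange K).IsSplit 0 (-(ε * p)) (-(ε * q)) where
  a₁ := by simp [WeierstrassCurve.baseChange, curve]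
  a₂ := by simp [WeierstrassCurve.baseChange, curve]; ring
  a₃ := by simp [WeierstrassCurve.baseChange, curve]
  a₄ := by simp [WeierstrassCurve.baseChange, curve]
  a₆ := by simp [WeierstrassCurve.baseChange, curve]
  ne₁₂ := by simp [eq_comm, hp, hε]
  ne₁₃ := by simp [eq_comm, hq, hε]
  ne₂₃ := by simp [hpq, hε]

end TwinPrimeCurve

theorem proposition3p1
    (p q : ℕ) (hp : p.Prime) (hq : q.Prime) (hp_odd : Odd p) (hq_odd : Odd q) (hpq : q = p + 2)
    (ε : ℤ) (hε : ε = 1 ∨ ε = -1)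
    (D : ℕ) (hD_one : 1 < D) (hD_sq : Squarefree D) (hD_odd : Odd D) (hD_cop : (p * q).Coprime D)
    (K : Type*) [Field K] [NumberField K] [DecidableEq K]
    (α : K) (hα : α ^ 2 = (D : K)) (hK : IntermediateField.adjoin ℚ {α} = ⊤) :
    Module.Finite ℤ ((TwinPrimeCurve.curve ε p q).baseChange K).toAffine.Point ∧
      Module.finrank ℤ ((TwinPrimeCurve.curve ε p q).baseChange K).toAffine.Point ≤
        14 + 2 * TwinPrimeCurve.dimTwoTorsion
          (Additive (TwinPrimeCurve.SClassGroup (𝓞 K)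
            (TwinPrimeCurve.placesDividing K (2 * p * q)))) := by
  have hε0 : ε ≠ 0 := by rcases hε with rfl | rfl <;> decide
  have hsplit := TwinPrimeCurve.isSplit_curve (K := K) hp.ne_zero hq.ne_zero (by omega) hε0
  have hvε {v : HeightOneSpectrum (𝓞 K)} (x : K) : v.valuation K (ε * x) = v.valuation K x := by
    rcases hε with rfl | rfl <;> simp [Valuation.map_neg]
  obtain ⟨hfin, hcard⟩ :=
    TwinPrimeCurve.placesDividing_two_mul_mul_finite_and_ncard_le (K := K) hp hq
  obtain ⟨hfg, hrank⟩ := WeierstrassCurve.Affine.Point.finite_and_finrank_add_two_le hsplit hfin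
    (fun v hv ↦ by
      rw [zero_sub, neg_neg, hvε]
      exact TwinPrimeCurve.valuation_natCast_eq_one ⟨2 * q, by ring⟩ hv)
    (fun v hv ↦ by
      rw [zero_sub, neg_neg, hvε]
      exact TwinPrimeCurve.valuation_natCast_eq_one ⟨2 * p, by ring⟩ hv)
    -- The twin condition enters here: the third difference is 2ε, so no primes beyond those
    -- dividing 2pq are needed.
    (fun v hv ↦ by
      rw [show -((ε : K) * p) - -(ε * q) = ε * (2 : ℕ) by rw [hpq]; push_cast; ring, hvε]
      exact TwinPrimeCurve.valuation_natCast_eq_one ⟨p * q, by ring⟩ hv)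
  have hdeg := TwinPrimeCurve.finrank_le_two_of_adjoin_sqrt hα hK
  have hunits := NumberField.Units.rank_lt_finrank K
  refine ⟨hfg, ?_⟩
  -- With unit rank + 1 ≤ 2 and at most 3 · 2 finite places, 2(2 + 6 + d) - 2 = 14 + 2d.
  omega
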